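/- Let $G$ be an archimedean lattice-ordered group (written additively; such a group is abelian), that is, if $a,b\ge 0$ in $G$ and $na\le b$ for all $n\in\mathbb N$, then $a=0$. For $S\subseteq G$ let $S^\perp=\{h\in G: |h|\wedge|s|=0\text{ for all }s\in S\}$, and write $g^{\perp\perp}$ for $(\{g\}^{\perp})^\perp$. Let $u\ge 0$ be a weak order unit of $G$, i.e. $\{u\}^\perp=\{0\}$ (so that $(G,u)$ is an object of the category $\mathbf W$). A convex $\ell$-subgroup of $G$ is an order-convex subgroup that is also a sublattice. Let $YG$ be the set of values of $u$, that is, of convex $\ell$-subgroups of $G$ maximal with respect to not containing $u$, equipped with the hull-kernel topology, which is generated by the sets $\operatorname{coz}(g)=\{V\in YG: g\notin V\}$, $g\in G$; put $Z(g)=YG\setminus\operatorname{coz}(g)$. A $d$-subgroup of $G$ is a convex $\ell$-subgroup $H$ such that $h^{\perp\perp}\subseteq H$ for every $h\in H$. Let $\operatorname{Max}_d(G)$ be the set of maximal proper $d$-subgroups of $G$, and for $g\in G$ let $U_d(g)=\{M\in\operatorname{Max}_d(G): g\notin M\}$ and $V_d(g)=\operatorname{Max}_d(G)\setminus U_d(g)$.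 Then for all $g,h\in G$ with $g,h\ge 0$ the following are equivalent: (1) $U_d(g)=U_d(h)$; (2) $V_d(g)=V_d(h)$; (3) $\operatorname{cl}\operatorname{coz}(g)=\operatorname{cl}\operatorname{coz}(h)$; (4) $\operatorname{cl}\operatorname{int}Z(g)=\operatorname{cl}\operatorname{int}Z(h)$; (5) $g^{\perp\perp}=h^{\perp\perp}$. (Closures and interiors are taken in $YG$.) -/

import Mathlib

namespace LGroup

section Defs

variable {G : Type*} [AddCommGroup G] [Lattice G]

/-- Archimedean in the sense of lattice-ordered groups (Mathlib's `Archimedean` is the much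
stronger condition that every strictly positive element is a strong order unit). -/
def IsArch (G : Type*) [AddCommGroup G] [Lattice G] : Prop :=
  ∀ a b : G, 0 ≤ a → 0 ≤ b → (∀ n : ℕ, n • a ≤ b) → a = 0

/-- The polar `S^⊥` of a subset of `G`. -/
def polar (S : Set G) : Set G := {h | ∀ g ∈ S, |h| ⊓ |g| = 0}

/-- `g` is a weak order unit if `g^⊥ = 0`. -/
def IsWeakUnit (g : G) : Prop := polar {g} = {0}

/-- The pair `(G, u)` is an object of the category **W**: `G` is an archimedean lattice-ordered
group and `u` is a positive weak order unit. -/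
structure IsWObject (u : G) : Prop where
  arch : IsArch G
  nonneg : 0 ≤ u
  weakUnit : IsWeakUnit u

/-- Convex `ℓ`-subgroups: subgroups that are sublattices and order-convex. -/
structure IsConvexLSubgroup (H : AddSubgroup G) : Prop where
  sup_mem : ∀ a ∈ H, ∀ b ∈ H, a ⊔ b ∈ H
  inf_mem : ∀ a ∈ H, ∀ b ∈ H, a ⊓ b ∈ H
  convex : ∀ a ∈ H, ∀ b ∈ H, ∀ x, a ≤ x → x ≤ b → x ∈ H

/-- The values of `u`: convex `ℓ`-subgroups maximal with respect to not containing `u`. -/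
def IsValue (u : G) (V : AddSubgroup G) : Prop :=
  Maximal (fun H : AddSubgroup G => IsConvexLSubgroup H ∧ u ∉ H) V

/-- The Yosida space of `(G, u)`, that is, the set of values of `u`. -/
def Yosida (u : G) : Type _ := {V : AddSubgroup G // IsValue u V}

/-- The cozero-set of `g` in the Yosida space. -/
def coz (u g : G) : Set (Yosida u) := {V | g ∉ V.1}

/-- The zero-set of `g` in the Yosida space. -/
def zeroSet (u g : G) : Set (Yosida u) := (coz u g)ᶜ

/-- The hull-kernel topology on the Yosida space, generated by the cozero-sets. -/
instance (u : G) : TopologicalSpace (Yosida u) :=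
  TopologicalSpace.generateFrom (Set.range (coz u))

/-- `d`-subgroups: convex `ℓ`-subgroups containing `h^⊥⊥` for each of their elements `h`. -/
structure IsDSubgroup (H : AddSubgroup G) : Prop where
  isConvexLSubgroup : IsConvexLSubgroup H
  polar_polar_subset : ∀ h ∈ H, polar (polar {h}) ⊆ (H : Set G)

/-- `Max_d(G)`: the maximal (proper) `d`-subgroups of `G`. -/
def MaxD (G : Type*) [AddCommGroup G] [Lattice G] : Type _ :=
  {M : AddSubgroup G // Maximal (fun H : AddSubgroup G => IsDSubgroup H ∧ H ≠ ⊤) M}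

/-- `U_d(g)`, the maximal `d`-subgroups not containing `g`. -/
def Ud (g : G) : Set (MaxD G) := {M | g ∉ M.1}

/-- `V_d(g)`, the complement of `U_d(g)` in `Max_d(G)`. -/
def Vd (g : G) : Set (MaxD G) := (Ud g)ᶜ

end Defs

end LGroup

namespace LGroup

/-! ### Meets of sums and multiples of positive elements. -/

section Order

variable {G : Type*} [AddCommGroup G] [Lattice G] [IsOrderedAddMonoid G]

/-! Each condition says that `g` and `h` have the same polar. On the Yosida side, cozero-sets form a
basis and two of them are disjoint exactly when the elements are, so `g^⊥` determines the closure of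
`coz g` and conversely. On the other side, a maximal `d`-subgroup respects double polars, so `g^⊥`
determines `U_d(g)`. The converses need enough points: each `c > 0` is missed by a value, and by a
maximal `d`-subgroup, containing `c^⊥`. Both come from `IsWObject.exists_polar`: if `nc ≰ u`, put `p
= (nc - u)⁺ ≠ 0`. Zorn enlarges `p^⊥` while avoiding `u`; the result omits `c`, since `u ≤ nc + (nc
- u)⁻` and `(nc - u)⁻ ∈ p^⊥`. -/

theorem inf_add_le_add_inf {a b c : G} (ha : 0 ≤ a) (hb : 0 ≤ b) (hc : 0 ≤ c) :
    a ⊓ (b + c) ≤ a ⊓ b + a ⊓ c := by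
  rw [inf_add, add_inf, add_inf]
  refine le_inf (le_inf ?_ ?_) (le_inf ?_ inf_le_right)
  · exact inf_le_left.trans (le_add_of_nonneg_left ha)
  · exact inf_le_left.trans (le_add_of_nonneg_right hc)
  · exact inf_le_left.trans (le_add_of_nonneg_left hb)

theorem inf_nsmul_le {a b : G} (ha : 0 ≤ a) (hb : 0 ≤ b) (n : ℕ) :
    a ⊓ n • b ≤ n • (a ⊓ b) := by
  induction n with
  | zero => simp [ha]
  | succ n ih =>
    rw [succ_nsmul, succ_nsmul]
    exact (inf_add_le_add_inf ha (nsmul_nonneg hb n) hb).trans (by gcongr)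

theorem nsmul_inf_nsmul_le {a b : G} (ha : 0 ≤ a) (hb : 0 ≤ b) (m n : ℕ) :
    m • a ⊓ n • b ≤ (n * m) • (a ⊓ b) := by
  refine (inf_nsmul_le (nsmul_nonneg ha m) hb n).trans ?_
  rw [mul_nsmul', inf_comm (m • a), inf_comm a]
  exact nsmul_le_nsmul_right (inf_nsmul_le hb ha m) n

end Order

/-! ### Polars as `d`-subgroups. -/

section Polar

variable {G : Type*} [AddCommGroup G] [Lattice G]

theorem mem_polar_singleton {a b : G} : a ∈ polar {b} ↔ |a| ⊓ |b| = 0 := by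
  simp [polar]

theorem polar_anti {S T : Set G} (h : S ⊆ T) : polar T ⊆ polar S :=
  fun _ hx g hg => hx g (h hg)

theorem subset_polar_polar (S : Set G) : S ⊆ polar (polar S) := fun x hx g hg => by
  rw [inf_comm]
  exact hg x hx

theorem polar_polar_polar (S : Set G) : polar (polar (polar S)) = polar S :=
  (polar_anti (subset_polar_polar S)).antisymm (subset_polar_polar _)

theorem polar_polar_eq_iff {S T : Set G} :
    polar (polar S) = polar (polar T) ↔ polar S = polar T :=
  ⟨fun h => by rw [← polar_polar_polar S, h, polar_polar_polar], fun h => by rw [h]⟩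

theorem IsConvexLSubgroup.abs_mem {H : AddSubgroup G} (hH : IsConvexLSubgroup H) {x : G}
    (hx : x ∈ H) : |x| ∈ H :=
  hH.sup_mem x hx _ (H.neg_mem hx)

theorem IsConvexLSubgroup.mem_of_nonneg_of_le {H : AddSubgroup G} (hH : IsConvexLSubgroup H)
    {x y : G} (hx : x ∈ H) (h0 : 0 ≤ y) (h : y ≤ x) : y ∈ H :=
  hH.convex _ H.zero_mem _ hx y h0 h

variable [IsOrderedAddMonoid G]

theorem mem_polar_of_abs_le {S : Set G} {x y : G} (hx : x ∈ polar S) (h : |y| ≤ |x|) :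
    y ∈ polar S := fun g hg =>
  le_antisymm ((inf_le_inf_right _ h).trans (hx g hg).le) (le_inf (abs_nonneg _) (abs_nonneg _))

theorem zero_mem_polar (S : Set G) : (0 : G) ∈ polar S := fun g _ => by simp

theorem add_mem_polar {S : Set G} {x y : G} (hx : x ∈ polar S) (hy : y ∈ polar S) :
    x + y ∈ polar S := fun g hg => by
  refine le_antisymm ?_ (le_inf (abs_nonneg _) (abs_nonneg _))
  calc |x + y| ⊓ |g| ≤ |g| ⊓ (|x| + |y|) := by
        rw [inf_comm]; exact inf_le_inf_left _ (abs_add_le x y)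
    _ ≤ |g| ⊓ |x| + |g| ⊓ |y| :=
        inf_add_le_add_inf (abs_nonneg _) (abs_nonneg _) (abs_nonneg _)
    _ = 0 := by rw [inf_comm, hx g hg, inf_comm, hy g hg, add_zero]

/-- The polar of a set, as a subgroup. -/
def polarSubgroup (S : Set G) : AddSubgroup G where
  carrier := polar S
  zero_mem' := zero_mem_polar S
  add_mem' := add_mem_polar
  neg_mem' := fun {x} hx => mem_polar_of_abs_le hx (abs_neg x).le

theorem isConvexLSubgroup_of_abs {H : AddSubgroup G}
    (hH : ∀ x ∈ H, ∀ y, |y| ≤ |x| → y ∈ H) : IsConvexLSubgroup H := by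
  have habs : ∀ x ∈ H, |x| ∈ H := fun x hx => hH x hx _ (abs_abs x).le
  have hsum : ∀ a ∈ H, ∀ b ∈ H, ∀ y, |y| ≤ |a| + |b| → y ∈ H := fun a ha b hb y hy =>
    hH _ (H.add_mem (habs a ha) (habs b hb)) y (hy.trans (le_abs_self _))
  have hle : ∀ a b : G, a ≤ |a| + |b| ∧ -a ≤ |a| + |b| := fun a b =>
    ⟨(le_abs_self a).trans (le_add_of_nonneg_right (abs_nonneg b)),
      (neg_le_abs a).trans (le_add_of_nonneg_right (abs_nonneg b))⟩
  refine ⟨fun a ha b hb => hsum a ha b hb _ ?_, fun a ha b hb => hsum a ha b hb _ ?_,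
    fun a ha b hb x hax hxb => hsum a ha b hb _ ?_⟩
  · refine sup_le (sup_le (hle a b).1 (add_comm |b| |a| ▸ (hle b a).1)) ?_
    exact (neg_le_neg le_sup_left).trans (hle a b).2
  · refine sup_le (inf_le_left.trans (hle a b).1) ?_
    rw [neg_inf]
    exact sup_le (hle a b).2 (add_comm |b| |a| ▸ (hle b a).2)
  · exact sup_le (hxb.trans (add_comm |b| |a| ▸ (hle b a).1))
      ((neg_le_neg hax).trans (hle a b).2)

theorem IsConvexLSubgroup.mem_of_abs_le {H : AddSubgroup G} (hH : IsConvexLSubgroup H) {x y : G}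
    (hx : x ∈ H) (h : |y| ≤ |x|) : y ∈ H :=
  hH.convex _ (H.neg_mem (hH.abs_mem hx)) _ (hH.abs_mem hx) y
    (neg_le.1 ((neg_le_abs y).trans h)) ((le_abs_self y).trans h)

theorem IsConvexLSubgroup.abs_mem_iff {H : AddSubgroup G} (hH : IsConvexLSubgroup H) {x : G} :
    |x| ∈ H ↔ x ∈ H :=
  ⟨fun h => hH.mem_of_abs_le h (abs_abs x).ge, hH.abs_mem⟩

theorem isDSubgroup_polarSubgroup (S : Set G) : IsDSubgroup (polarSubgroup S) where
  isConvexLSubgroup := isConvexLSubgroup_of_abs fun _ hx _ h => mem_polar_of_abs_le hx h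
  polar_polar_subset h hh := by
    have : polar (polar {h}) ⊆ polar (polar (polar S)) :=
      polar_anti (polar_anti (Set.singleton_subset_iff.2 hh))
    rwa [polar_polar_polar] at this

end Polar

/-! ### Unions of chains and Zorn's lemma. -/

section Chains

variable {G : Type*} [AddCommGroup G]

theorem exists_mem_mem_of_isChain {c : Set (AddSubgroup G)} (hc : IsChain (· ≤ ·) c)
    {H K : AddSubgroup G} (hH : H ∈ c) (hK : K ∈ c) {a b : G} (ha : a ∈ H) (hb : b ∈ K) :
    ∃ L ∈ c, a ∈ L ∧ b ∈ L := by
  rcases hc.total hH hK with h | h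
  · exact ⟨K, hK, h ha, hb⟩
  · exact ⟨H, hH, ha, h hb⟩

theorem exists_le_maximal_of_sSup {P : AddSubgroup G → Prop} {u : G}
    (hP : ∀ c : Set (AddSubgroup G), IsChain (· ≤ ·) c → c.Nonempty → (∀ H ∈ c, P H) →
      P (sSup c))
    {H : AddSubgroup G} (hH : P H) (hu : u ∉ H) :
    ∃ M, H ≤ M ∧ Maximal (fun K => P K ∧ u ∉ K) M := by
  refine zorn_le_nonempty₀ {K | P K ∧ u ∉ K} (fun c hcs hc y hy => ?_) H ⟨hH, hu⟩
  refine ⟨sSup c, ⟨hP c hc ⟨y, hy⟩ fun K hK => (hcs hK).1, fun h => ?_⟩, fun _ => le_sSup⟩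
  obtain ⟨K, hK, huK⟩ := (AddSubgroup.mem_sSup_of_directedOn ⟨y, hy⟩ hc.directedOn).1 h
  exact (hcs hK).2 huK

variable [Lattice G]

theorem isConvexLSubgroup_sSup {c : Set (AddSubgroup G)} (hc : IsChain (· ≤ ·) c)
    (hne : c.Nonempty) (h : ∀ H ∈ c, IsConvexLSubgroup H) : IsConvexLSubgroup (sSup c) := by
  have hmem {x : G} := AddSubgroup.mem_sSup_of_directedOn (x := x) hne hc.directedOn
  refine ⟨fun a ha b hb => ?_, fun a ha b hb => ?_, fun a ha b hb x hax hxb => ?_⟩ <;>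
  · obtain ⟨H, hH, ha⟩ := hmem.1 ha
    obtain ⟨K, hK, hb⟩ := hmem.1 hb
    obtain ⟨L, hL, ha, hb⟩ := exists_mem_mem_of_isChain hc hH hK ha hb
    refine hmem.2 ⟨L, hL, ?_⟩
    first
      | exact (h L hL).sup_mem a ha b hb
      | exact (h L hL).inf_mem a ha b hb
      | exact (h L hL).convex a ha b hb x hax hxb

theorem isDSubgroup_sSup {c : Set (AddSubgroup G)} (hc : IsChain (· ≤ ·) c)
    (hne : c.Nonempty) (h : ∀ H ∈ c, IsDSubgroup H) : IsDSubgroup (sSup c) := by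
  refine ⟨isConvexLSubgroup_sSup hc hne fun H hH => (h H hH).isConvexLSubgroup, fun a ha => ?_⟩
  obtain ⟨H, hH, ha⟩ := (AddSubgroup.mem_sSup_of_directedOn hne hc.directedOn).1 ha
  exact ((h H hH).polar_polar_subset a ha).trans fun x hx => le_sSup hH hx

theorem exists_isValue_ge {u : G} {H : AddSubgroup G} (hH : IsConvexLSubgroup H) (hu : u ∉ H) :
    ∃ V : Yosida u, H ≤ V.1 :=
  have ⟨V, hV, hmax⟩ := exists_le_maximal_of_sSup
    (fun _ hc hne h => isConvexLSubgroup_sSup hc hne h) hH hu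
  ⟨⟨V, hmax⟩, hV⟩

end Chains

/-! ### Existence of values and maximal `d`-subgroups missing a given element. -/

section WeakUnit

variable {G : Type*} [AddCommGroup G] [Lattice G] [IsOrderedAddMonoid G] {u : G}

theorem IsWeakUnit.polar_polar (hu : IsWeakUnit u) : polar (polar {u}) = Set.univ := by
  rw [show polar {u} = {0} from hu]
  exact Set.eq_univ_of_forall fun x => mem_polar_singleton.2 (by simp)

theorem IsWeakUnit.notMem_polar (hu : IsWeakUnit u) {c : G} (hc : c ≠ 0) : u ∉ polar {c} := by
  intro h
  have : c ∈ polar {u} := by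
    rw [mem_polar_singleton, inf_comm]
    exact mem_polar_singleton.1 h
  rw [show polar {u} = {0} from hu] at this
  exact hc this

/-- Since `u^⊥⊥ = G`, properness becomes avoidance of one element, a condition that survives unions
of chains. -/
theorem IsDSubgroup.ne_top_iff (hu : IsWeakUnit u) {H : AddSubgroup G} (hH : IsDSubgroup H) :
    H ≠ ⊤ ↔ u ∉ H := by
  refine ⟨fun h hm => h ?_, fun h ht => h (ht ▸ AddSubgroup.mem_top u)⟩
  have := hH.polar_polar_subset u hm
  rw [hu.polar_polar] at this
  exact (AddSubgroup.eq_top_iff' H).2 fun x => this (Set.mem_univ x)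

theorem exists_maxD_ge (hu : IsWeakUnit u) {H : AddSubgroup G} (hH : IsDSubgroup H)
    (hH' : u ∉ H) : ∃ M : MaxD G, H ≤ M.1 := by
  obtain ⟨M, hM, hmax⟩ := exists_le_maximal_of_sSup
    (fun _ hc hne h => isDSubgroup_sSup hc hne h) hH hH'
  refine ⟨⟨M, ⟨hmax.prop.1, (hmax.prop.1.ne_top_iff hu).2 hmax.prop.2⟩, fun K hK hMK => ?_⟩, hM⟩
  exact hmax.2 ⟨hK.1, (hK.1.ne_top_iff hu).1 hK.2⟩ hMK

/-- In a **W**-object, every positive `c` has a nonzero `p` below a multiple of `c` such that a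
convex `ℓ`-subgroup containing both `p^⊥` and `c` contains the unit. -/
theorem IsWObject.exists_polar (hu : IsWObject u) {c : G} (hc : 0 ≤ c) (hc' : c ≠ 0) :
    ∃ p : G, p ≠ 0 ∧ polar {c} ⊆ polar {p} ∧ ∀ H : AddSubgroup G, IsConvexLSubgroup H →
      polarSubgroup {p} ≤ H → c ∈ H → u ∈ H := by
  -- The only use of the archimedean property.
  obtain ⟨n, hn⟩ : ∃ n : ℕ, ¬ n • c ≤ u := by
    by_contra! h
    exact hc' (hu.arch c u hc hu.nonneg h)
  have hple : (n • c - u)⁺ ≤ n • c :=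
    sup_le (sub_le_self _ hu.nonneg) (nsmul_nonneg hc n)
  refine ⟨(n • c - u)⁺, fun h => hn (sub_nonpos.1 (posPart_eq_zero.1 h)), fun x hx => ?_,
    fun H hH hpH hcH => ?_⟩
  · rw [mem_polar_singleton, abs_of_nonneg hc] at hx
    rw [mem_polar_singleton, abs_of_nonneg (posPart_nonneg _)]
    refine le_antisymm ?_ (le_inf (abs_nonneg _) (posPart_nonneg _))
    calc |x| ⊓ (n • c - u)⁺ ≤ |x| ⊓ n • c := inf_le_inf_left _ hple
      _ ≤ n • (|x| ⊓ c) := inf_nsmul_le (abs_nonneg x) hc n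
      _ = 0 := by rw [hx, smul_zero]
  · have hneg : (n • c - u)⁻ ∈ H := hpH (mem_polar_singleton.2 (by
      rw [abs_of_nonneg (posPart_nonneg _), abs_of_nonneg (negPart_nonneg _), inf_comm]
      exact posPart_inf_negPart_eq_zero _))
    refine hH.mem_of_nonneg_of_le (H.add_mem (H.nsmul_mem hcH n) hneg) hu.nonneg ?_
    have h1 := posPart_sub_negPart (n • c - u)
    have h2 : n • c + (n • c - u)⁻ = u + (n • c - u)⁺ := by
      rw [sub_eq_sub_iff_add_eq_add] at h1
      rw [← h1, add_comm]
    rw [h2]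
    exact le_add_of_nonneg_right (posPart_nonneg _)

theorem IsWObject.exists_isValue_notMem (hu : IsWObject u) {c : G} (hc : 0 ≤ c) (hc' : c ≠ 0) :
    ∃ V : Yosida u, c ∉ V.1 ∧ polar {c} ⊆ (V.1 : Set G) := by
  obtain ⟨p, hp, hcp, h⟩ := hu.exists_polar hc hc'
  obtain ⟨V, hV⟩ := exists_isValue_ge (isDSubgroup_polarSubgroup {p}).isConvexLSubgroup
    (hu.weakUnit.notMem_polar hp)
  exact ⟨V, fun hcV => V.2.prop.2 (h V.1 V.2.prop.1 hV hcV), fun _ hx => hV (hcp hx)⟩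

theorem IsWObject.exists_maxD_notMem (hu : IsWObject u) {c : G} (hc : 0 ≤ c) (hc' : c ≠ 0) :
    ∃ M : MaxD G, c ∉ M.1 ∧ polar {c} ⊆ (M.1 : Set G) := by
  obtain ⟨p, hp, hcp, h⟩ := hu.exists_polar hc hc'
  obtain ⟨M, hM⟩ := exists_maxD_ge hu.weakUnit (isDSubgroup_polarSubgroup {p})
    (hu.weakUnit.notMem_polar hp)
  have hMd : IsDSubgroup M.1 := M.2.prop.1
  exact ⟨M, fun hcM => (hMd.ne_top_iff hu.weakUnit).1 M.2.prop.2
    (h M.1 hMd.isConvexLSubgroup hM hcM), fun _ hx => hM (hcp hx)⟩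

end WeakUnit

/-! ### Primeness of values and the topology of the Yosida space. -/

section Prime

variable {G : Type*} [AddCommGroup G] [Lattice G] {u : G}

theorem isOpen_coz (g : G) : IsOpen (coz u g) :=
  TopologicalSpace.isOpen_generateFrom_of_mem ⟨g, rfl⟩

variable [IsOrderedAddMonoid G]

/-- The convex `ℓ`-subgroup generated by a convex `ℓ`-subgroup and a positive element. -/
def convexAdjoin (V : AddSubgroup G) (a : G) : AddSubgroup G where
  carrier := {x | ∃ v ∈ V, ∃ n : ℕ, |x| ≤ v + n • a}
  zero_mem' := ⟨0, V.zero_mem, 0, by simp⟩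
  add_mem' := by
    rintro x y ⟨v, hv, n, hx⟩ ⟨w, hw, m, hy⟩
    refine ⟨v + w, V.add_mem hv hw, n + m, (abs_add_le x y).trans ((add_le_add hx hy).trans ?_)⟩
    rw [add_nsmul, add_add_add_comm]
  neg_mem' := by
    rintro x ⟨v, hv, n, hx⟩
    exact ⟨v, hv, n, (abs_neg x).le.trans hx⟩

theorem isConvexLSubgroup_convexAdjoin (V : AddSubgroup G) (a : G) :
    IsConvexLSubgroup (convexAdjoin V a) :=
  isConvexLSubgroup_of_abs fun _ ⟨v, hv, n, hx⟩ _ h => ⟨v, hv, n, h.trans hx⟩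

theorem IsValue.exists_le_add_nsmul {V : AddSubgroup G} (hV : IsValue u V) {a : G} (ha : 0 ≤ a)
    (haV : a ∉ V) : ∃ v ∈ V, ∃ n : ℕ, 0 ≤ v ∧ u ≤ v + n • a := by
  by_contra! hcon
  have hu : u ∉ convexAdjoin V a := by
    rintro ⟨v, hv, n, h⟩
    refine hcon |v| (hV.prop.1.abs_mem hv) n (abs_nonneg v) ((le_abs_self u).trans (h.trans ?_))
    gcongr
    exact le_abs_self v
  refine haV (hV.2 ⟨isConvexLSubgroup_convexAdjoin V a, hu⟩ (fun x hx => ?_)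
    ⟨0, V.zero_mem, 1, by simp [abs_of_nonneg ha]⟩)
  exact ⟨|x|, hV.prop.1.abs_mem hx, 0, by simp⟩

/-- By maximality, `u` lies below both `v + ma` and `w + nb` with `v, w ∈ V` positive, hence below
`v + w + (ma ⊓ nb)`. As `ma ⊓ nb ≤ nm(a ⊓ b)`, having `a ⊓ b` in `V` would force `u ∈ V`. -/
theorem IsValue.inf_notMem {V : AddSubgroup G} (hV : IsValue u V) (hu : 0 ≤ u) {a b : G}
    (ha : 0 ≤ a) (hb : 0 ≤ b) (haV : a ∉ V) (hbV : b ∉ V) : a ⊓ b ∉ V := by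
  intro hab
  obtain ⟨v, hv, m, hv0, hvu⟩ := hV.exists_le_add_nsmul ha haV
  obtain ⟨w, hw, n, hw0, hwu⟩ := hV.exists_le_add_nsmul hb hbV
  refine hV.prop.2 (hV.prop.1.mem_of_nonneg_of_le
    (V.add_mem (V.add_mem hv hw) (V.nsmul_mem hab (n * m))) hu ?_)
  calc u ≤ (v + w + m • a) ⊓ (v + w + n • b) := by
        refine le_inf (hvu.trans ?_) (hwu.trans ?_) <;> gcongr
        · exact le_add_of_nonneg_right hw0
        · exact le_add_of_nonneg_left hv0
    _ = v + w + m • a ⊓ n • b := by rw [add_inf]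
    _ ≤ _ := by gcongr; exact nsmul_inf_nsmul_le ha hb m n

theorem isTopologicalBasis_coz (hu : 0 ≤ u) :
    TopologicalSpace.IsTopologicalBasis (Set.range (coz u)) where
  exists_subset_inter := by
    rintro _ ⟨f, rfl⟩ _ ⟨g, rfl⟩ V ⟨hf, hg⟩
    have key (W : Yosida u) (x : G) : |x| ∈ W.1 ↔ x ∈ W.1 := W.2.prop.1.abs_mem_iff
    refine ⟨_, ⟨|f| ⊓ |g|, rfl⟩, V.2.inf_notMem hu (abs_nonneg f) (abs_nonneg g)
      (mt (key V f).1 hf) (mt (key V g).1 hg), fun W hW => ?_⟩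
    have h0 : 0 ≤ |f| ⊓ |g| := le_inf (abs_nonneg f) (abs_nonneg g)
    exact ⟨fun h => hW (W.2.prop.1.mem_of_nonneg_of_le ((key W f).2 h) h0 inf_le_left),
      fun h => hW (W.2.prop.1.mem_of_nonneg_of_le ((key W g).2 h) h0 inf_le_right)⟩
  sUnion_eq := Set.eq_univ_of_forall fun V => ⟨_, ⟨u, rfl⟩, V.2.prop.2⟩
  eq_generateFrom := rfl

theorem IsWObject.coz_inter_coz_eq_empty_iff (hu : IsWObject u) (f g : G) :
    coz u f ∩ coz u g = ∅ ↔ f ∈ polar {g} := by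
  have key (W : Yosida u) (x : G) : |x| ∈ W.1 ↔ x ∈ W.1 := W.2.prop.1.abs_mem_iff
  have h0 : 0 ≤ |f| ⊓ |g| := le_inf (abs_nonneg f) (abs_nonneg g)
  rw [mem_polar_singleton]
  constructor
  · intro h
    by_contra hne
    obtain ⟨V, hV, -⟩ := hu.exists_isValue_notMem h0 hne
    refine Set.notMem_empty V (h ▸ ⟨fun hf => hV ?_, fun hg => hV ?_⟩)
    · exact V.2.prop.1.mem_of_nonneg_of_le ((key V f).2 hf) h0 inf_le_left
    · exact V.2.prop.1.mem_of_nonneg_of_le ((key V g).2 hg) h0 inf_le_right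
  · refine fun h => Set.eq_empty_of_forall_notMem fun V ⟨hf, hg⟩ => ?_
    refine V.2.inf_notMem hu.nonneg (abs_nonneg f) (abs_nonneg g)
      (mt (key V f).1 hf) (mt (key V g).1 hg) ?_
    rw [h]
    exact V.1.zero_mem

theorem IsWObject.closure_coz_subset_iff (hu : IsWObject u) (g h : G) :
    closure (coz u g) ⊆ closure (coz u h) ↔ polar {h} ⊆ polar {g} := by
  constructor
  · intro hcl f hf
    rw [← hu.coz_inter_coz_eq_empty_iff, ← Set.disjoint_iff_inter_eq_empty] at hf ⊢
    exact (hf.closure_right (isOpen_coz f)).mono_right (subset_closure.trans hcl)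
  · refine fun hp => closure_minimal (fun V hV => ?_) isClosed_closure
    rw [(isTopologicalBasis_coz hu.nonneg).mem_closure_iff]
    rintro _ ⟨f, rfl⟩ hf
    rw [Set.nonempty_iff_ne_empty, Ne, hu.coz_inter_coz_eq_empty_iff]
    intro hfh
    have := (hu.coz_inter_coz_eq_empty_iff f g).2 (hp hfh)
    exact Set.notMem_empty V (this ▸ ⟨hf, hV⟩)

theorem IsWObject.closure_coz_eq_iff (hu : IsWObject u) (g h : G) :
    closure (coz u g) = closure (coz u h) ↔ polar {g} = polar {h} := by
  rw [Set.Subset.antisymm_iff, hu.closure_coz_subset_iff, hu.closure_coz_subset_iff, and_comm,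
    ← Set.Subset.antisymm_iff]

/-- The left-hand sets are the complements of the interiors of the right-hand ones, and the closure
of an open set is recovered from its interior by closing again. -/
theorem closure_interior_zeroSet_eq_iff (g h : G) :
    closure (interior (zeroSet u g)) = closure (interior (zeroSet u h)) ↔
      closure (coz u g) = closure (coz u h) := by
  have hreg (f : G) : closure (interior (closure (coz u f))) = closure (coz u f) :=
    (closure_minimal interior_subset isClosed_closure).antisymm
      (closure_mono (interior_maximal subset_closure (isOpen_coz f)))
  simp only [zeroSet, interior_compl, closure_compl, compl_inj_iff]
  exact ⟨fun e => by rw [← hreg g, e, hreg h], fun e => by rw [e]⟩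

end Prime

/-! ### Maximal `d`-subgroups detect polars. -/

section MaximalDSubgroups

variable {G : Type*} [AddCommGroup G] [Lattice G]

theorem Ud_subset_of_polar_subset {g h : G} (hp : polar {h} ⊆ polar {g}) : Ud g ⊆ Ud h :=
  fun M hg hM => hg ((M.2.prop.1).polar_polar_subset h hM
    (polar_anti hp (subset_polar_polar {g} rfl)))

variable [IsOrderedAddMonoid G] {u : G}

theorem IsWObject.polar_subset_of_Ud_subset (hu : IsWObject u) {g h : G}
    (hU : Ud g ⊆ Ud h) : polar {h} ⊆ polar {g} := by
  intro f hf
  rw [mem_polar_singleton] at hf ⊢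
  by_contra hne
  have h0 : 0 ≤ |f| ⊓ |g| := le_inf (abs_nonneg f) (abs_nonneg g)
  obtain ⟨M, hM, hpM⟩ := hu.exists_maxD_notMem h0 hne
  have hMc : IsConvexLSubgroup M.1 := M.2.prop.1.isConvexLSubgroup
  -- With `c = |f| ⊓ |g|`, omitting `c` makes `M` omit `g`, hence `h`; but `h ∈ c^⊥ ⊆ M` because `f
  -- ⊥ h`.
  refine hU (show g ∉ M.1 from fun hg => hM ?_) (hpM ?_)
  · exact hMc.mem_of_nonneg_of_le (hMc.abs_mem hg) h0 inf_le_right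
  · rw [mem_polar_singleton, abs_of_nonneg h0]
    refine le_antisymm ?_ (le_inf (abs_nonneg _) h0)
    rw [← hf, inf_comm]
    exact inf_le_inf_right _ inf_le_left

theorem IsWObject.Ud_eq_iff (hu : IsWObject u) (g h : G) :
    Ud g = Ud h ↔ polar {g} = polar {h} :=
  ⟨fun e => (hu.polar_subset_of_Ud_subset e.ge).antisymm (hu.polar_subset_of_Ud_subset e.le),
    fun e => (Ud_subset_of_polar_subset e.ge).antisymm (Ud_subset_of_polar_subset e.le)⟩

end MaximalDSubgroups

end LGroup

theorem mainTheorem2 {G : Type*} [AddCommGroup G] [Lattice G] [IsOrderedAddMonoid G]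
    (u : G) (hu : LGroup.IsWObject u) (g h : G) (hg : 0 ≤ g) (hh : 0 ≤ h) :
    List.TFAE
      [LGroup.Ud g = LGroup.Ud h,
       LGroup.Vd g = LGroup.Vd h,
       closure (LGroup.coz u g) = closure (LGroup.coz u h),
       closure (interior (LGroup.zeroSet u g)) = closure (interior (LGroup.zeroSet u h)),
       LGroup.polar (LGroup.polar {g}) = LGroup.polar (LGroup.polar {h})] := by
  tfae_have 1 ↔ 2 := compl_inj_iff.symm
  tfae_have 4 ↔ 3 := LGroup.closure_interior_zeroSet_eq_iff g h
  tfae_have 1 ↔ 5 := (hu.Ud_eq_iff g h).trans LGroup.polar_polar_eq_iff.symm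
  tfae_have 3 ↔ 5 := (hu.closure_coz_eq_iff g h).trans LGroup.polar_polar_eq_iff.symm
  tfae_finish
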